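/- Let $k\ge 3$ be odd and let $G_{k,3}$ be the $k$-uniform loose path of length three, i.e. the hypergraph with vertex set $\{1,\dots,3k-2\}$ and the three edges $\{1,\dots,k\}$, $\{k,\dots,2k-1\}$, $\{2k-1,\dots,3k-2\}$ (up to renaming the vertices). Let $n=3k-2$ and let $\mathcal L=\mathcal D-\mathcal A$ be its Laplacian tensor of order $k$ and dimension $n$, where $\mathcal A$ has $(i_1,\dots,i_k)$-entry $\frac1{(k-1)!}$ if $\{i_1,\dots,i_k\}$ is an edge and $0$ otherwise, and $\mathcal D$ is the diagonal tensor whose $i$-th diagonal entry is the degree of the vertex $i$ (the number of edges containing $i$). A real number $\lambda$ is an H-eigenvalue of $\mathcal L$ if there is $x\in\mathbb R^n\setminus\{0\}$ with $(\lambda\mathcal I-\mathcal L)x^{k-1}=0$, where $\mathcal I$ is the identity tensor and $(\mathcal T x^{k-1})_i=\sum_{i_2,\dots,i_k}t_{ii_2\cdots i_k}x_{i_2}\cdots x_{i_k}$. Then a real number $\lambda$ is an H-eigenvalue of $\mathcal L$ with $\lambda\neq 1$ if and only if one of the following five cases holds: (i) $\lambda=0$ or $\lambda=2$; (ii) $\lambda$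 is the root of $(\lambda-2)(1-\lambda)^{k-1}+1=0$; this equation has exactly one real root, and it lies in $(0,1)$; (iii) $\lambda$ is the root of $(\lambda-2)^2(1-\lambda)^{k-2}-1=0$; this equation has exactly one real root, and it lies in $(0,1)$; (iv) $\lambda$ is a real root of $(\lambda-2)^2(1-\lambda)^{k-1}+2\lambda-3=0$; this equation has exactly two real roots, one in $(0,1)$ and the other in $\bigl(1,\frac{2k}{k+1}\bigr)$; (v) $\lambda$ is the root in $(0,1)$ of $[(\lambda-2)(\lambda-1)^{k-1}+1]^2-(1-\lambda)^k=0$; this equation has exactly one root in $(0,1)$. The cases (i)--(v) give exactly $7$ distinct H-eigenvalues different from $1$. The number $1$ is also an H-eigenvalue of $\mathcal L$, so that $\mathcal L$ has exactly $8$ H-eigenvalues. -/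

import Mathlib

/-- A real tensor of order `k` (with `k ≥ 1`) whose indices run over `V`: the entry
`t_{i i_2 ... i_k}` is `T i ![i_2, ..., i_k]`. -/
abbrev RealTensor (V : Type*) (k : ℕ) : Type _ := V → (Fin (k - 1) → V) → ℝ

namespace RealTensor

/-- The vector `T x^{k-1}`, whose `i`-th coordinate is the sum over all `i_2, ..., i_k` of
`t_{i i_2 ... i_k} x_{i_2} ... x_{i_k}`. -/
def applyVec {V : Type*} {k : ℕ} [Fintype V] (T : RealTensor V k) (x : V → ℝ) : V → ℝ :=
  fun i => ∑ j : Fin (k - 1) → V, T i j * ∏ r, x (j r)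

open Classical in
/-- The diagonal tensor of order `k` with diagonal entries `d i`. -/
noncomputable def diagonal {V : Type*} (k : ℕ) (d : V → ℝ) : RealTensor V k :=
  fun i j => if ∀ r, j r = i then d i else 0

/-- The identity tensor of order `k`. -/
noncomputable def identity (V : Type*) (k : ℕ) : RealTensor V k :=
  diagonal k (fun _ => 1)

/-- The real number `l` is an H-eigenvalue of `T` if `(l I - T) x^{k-1} = 0` for some nonzero
real vector `x`. -/
def IsHEigenvalue {V : Type*} {k : ℕ} [Fintype V] (T : RealTensor V k) (l : ℝ) : Prop :=
  ∃ x : V → ℝ, x ≠ 0 ∧ applyVec (l • identity V k - T) x = 0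

end RealTensor

namespace Hypergraph

/-- All edges have exactly `k` vertices. -/
def IsUniform {α : Type*} (H : Hypergraph α) (k : ℕ) : Prop :=
  ∀ e ∈ H.edgeSet, e.encard = k

/-- The degree of a vertex: the number of edges that contain it. -/
noncomputable def degree {α : Type*} (H : Hypergraph α) (v : α) : ℕ :=
  {e : Set α | e ∈ H.edgeSet ∧ v ∈ e}.ncard

open Classical in
/-- The adjacency tensor of a `k`-uniform hypergraph, indexed by its vertices: the
`(i_1, ..., i_k)` entry is `1 / (k-1)!` if `{i_1, ..., i_k}` is an edge, and `0` otherwise. -/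
noncomputable def adjacencyTensor {α : Type*} (H : Hypergraph α) (k : ℕ) :
    RealTensor H.vertexSet k :=
  fun i j => if insert (i : α) (Set.range (fun r => (j r : α))) ∈ H.edgeSet
    then 1 / ((k - 1).factorial : ℝ) else 0

/-- The Laplacian tensor `D - A` of a `k`-uniform hypergraph, where `D` is the diagonal tensor of
the degrees. -/
noncomputable def laplacianTensor {α : Type*} (H : Hypergraph α) (k : ℕ) :
    RealTensor H.vertexSet k :=
  RealTensor.diagonal k (fun v : H.vertexSet => (H.degree (v : α) : ℝ)) - H.adjacencyTensor k

/-- `H` is a `k`-uniform loose path of length `d`: its vertices can be numbered bijectively by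
`0, 1, ..., d (k-1)` so that its edges are the `d` blocks
`{j (k-1), j (k-1) + 1, ..., (j+1) (k-1)}` for `j = 0, ..., d-1`; thus consecutive edges share
exactly one vertex, the last of the one and the first of the next. -/
def IsLoosePath {α : Type*} (H : Hypergraph α) (k d : ℕ) : Prop :=
  0 < d ∧ H.IsUniform k ∧ ∃ f : Fin (d * (k - 1) + 1) ≃ H.vertexSet,
    H.edgeSet = Set.range (fun j : Fin d =>
      (fun m => (f m : α)) '' {m : Fin (d * (k - 1) + 1) |
        (j : ℕ) * (k - 1) ≤ (m : ℕ) ∧ (m : ℕ) ≤ ((j : ℕ) + 1) * (k - 1)})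

end Hypergraph

/-! Put n = k - 1 and μ = 1 - l, and suppose μ ≠ 0. At a vertex i of degree one the eigenvalue
equation says that μ x_i^n is the product of the other coordinates in its edge. Multiplying by x_i
turns the right side into the product over the whole edge, and k-th powers are injective on ℝ
because k is odd. So x is constant on the degree-one vertices of each edge, and five unknowns
remain: a, b, c on these vertices and u, v at the two joints (`LoosePathSystem`).

If b = 0 the two ends decouple, and a nonzero end gives 1 + μ = 0 or (1 + μ) μ^n = 1. If b ≠ 0 then
u v = μ b², and the first end edge contributes (1 + μ) u^k = μ b^k when a = 0, or ((1 + μ) μ^n - 1)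
u^k = μ^k b^k when a ≠ 0; the other end behaves likewise with v and c. Multiplying one relation for
u by one for v and cancelling u^k v^k = μ^k b^(2k) leaves three more equations in μ alone
(`cases_of_loosePathSystem`). Conversely, each of the five equations yields an explicit solution,
supported on a single joint, an end edge, the middle edge, two adjacent edges, or the whole path.

It remains to count real roots, by the intermediate value theorem and monotonicity. The value l = 0
is the root μ = 1 of the last equation. Roots of different equations differ, since eliminating the
power of μ between two of them leaves a relation of low degree with no solution in (0,1). -/

open Finset in
/-- Summing a product over all enumerations of a finite set of size `n`. -/
theorem sum_ite_image_eq_prod {V : Type*} [Fintype V] [DecidableEq V] {n : ℕ} (S : Finset V)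
    (hS : S.card = n) (x : V → ℝ) :
    ∑ j : Fin n → V, (if univ.image j = S then ∏ r, x (j r) else 0)
      = (n.factorial : ℝ) * ∏ v ∈ S, x v := by
  classical
  have hinj : ∀ j : Fin n → V, univ.image j = S → Function.Injective j := by
    intro j hj
    have : (univ.image j).card = (univ : Finset (Fin n)).card := by simp [hj, hS]
    have := Finset.card_image_iff.1 this
    simpa using this
  have hprod : ∀ j : Fin n → V, univ.image j = S → ∏ r, x (j r) = ∏ v ∈ S, x v := by
    intro j hj
    rw [← hj, Finset.prod_image]
    intro a _ b _ h
    exact hinj j hj h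
  have hcard : (univ.filter fun j : Fin n → V => univ.image j = S).card = n.factorial := by
    have e0 : Fin n ≃ S := Fintype.equivOfCardEq (by simp [hS])
    have hc := Fintype.card_equiv e0
    rw [Fintype.card_fin] at hc
    rw [← hc, ← Finset.card_univ]
    symm
    refine Finset.card_bij (fun (e : Fin n ≃ S) _ => fun r => (e r : V)) ?_ ?_ ?_
    · intro e _
      simp only [mem_filter, mem_univ, true_and]
      ext v
      simp only [mem_image, mem_univ, true_and]
      constructor
      · rintro ⟨r, rfl⟩
        exact (e r).2
      · intro hv
        exact ⟨e.symm ⟨v, hv⟩, by simp⟩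
    · intro e _ e' _ h
      ext r
      exact congrFun h r
    · intro j hj
      simp only [mem_filter, mem_univ, true_and] at hj
      have hm : ∀ r, j r ∈ S := fun r => hj ▸ mem_image_of_mem j (mem_univ r)
      refine ⟨Equiv.ofBijective (fun r => (⟨j r, hm r⟩ : S)) ⟨?_, ?_⟩, mem_univ _, rfl⟩
      · intro a b h
        exact hinj j hj (by simpa using h)
      · rintro ⟨v, hv⟩
        rw [← hj] at hv
        obtain ⟨r, -, rfl⟩ := mem_image.1 hv
        exact ⟨r, rfl⟩
  rw [← Finset.sum_filter, Finset.sum_congr rfl (g := fun _ => ∏ v ∈ S, x v)]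
  · rw [Finset.sum_const, hcard, nsmul_eq_mul]
  · intro j hj
    exact hprod j (mem_filter.1 hj).2

/-! ### Linearity of the tensor action and diagonal tensors -/

namespace RealTensor

theorem applyVec_sub {V : Type*} {k : ℕ} [Fintype V] (S T : RealTensor V k) (x : V → ℝ) :
    applyVec (S - T) x = applyVec S x - applyVec T x := by
  ext i
  simp [applyVec, sub_mul, Finset.sum_sub_distrib]

theorem applyVec_smul {V : Type*} {k : ℕ} [Fintype V] (c : ℝ) (T : RealTensor V k) (x : V → ℝ) :
    applyVec (c • T) x = c • applyVec T x := by
  ext i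
  simp [applyVec, mul_assoc, Finset.mul_sum]

theorem applyVec_diagonal {V : Type*} {k : ℕ} [Fintype V] (d x : V → ℝ) (i : V) :
    applyVec (diagonal k d) x i = d i * x i ^ (k - 1) := by
  classical
  unfold applyVec diagonal
  rw [Finset.sum_eq_single (fun _ => i)]
  · simp
  · intro j _ hj
    rw [if_neg, zero_mul]
    exact fun h => hj (funext h)
  · simp

end RealTensor

/-! ### Eigenvalue equations of a uniform hypergraph, edge by edge -/

namespace Hypergraph

variable {α ι : Type*} [Fintype ι] {H : Hypergraph α}

-- The entry at (i, t) is nonzero exactly when t enumerates e_j without i for some edge e_j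
-- containing i. There are n! such t, which cancels the factor 1/n!.
open Classical in
theorem adjacencyTensor_applyVec [Fintype H.vertexSet] {n : ℕ} (e : ι → Finset H.vertexSet)
    (he : Function.Injective e) (hc : ∀ j, (e j).card = n + 1)
    (hE : H.edgeSet = Set.range fun j => Subtype.val '' (e j : Set H.vertexSet))
    (x : H.vertexSet → ℝ) (i : H.vertexSet) :
    RealTensor.applyVec (H.adjacencyTensor (n + 1)) x i
      = ∑ j, if i ∈ e j then ∏ v ∈ (e j).erase i, x v else 0 := by
  have key : ∀ t : Fin n → H.vertexSet,
      H.adjacencyTensor (n + 1) i t * ∏ r, x (t r)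
        = ∑ j, if i ∈ e j then
            (1 / (n.factorial : ℝ)) *
              (if Finset.univ.image t = (e j).erase i then ∏ r, x (t r) else 0) else 0 := by
    intro t
    have h1 : ∀ j, (insert (i : α) (Set.range fun r => (t r : α)) =
        Subtype.val '' (e j : Set H.vertexSet)) ↔
          (i ∈ e j ∧ Finset.univ.image t = (e j).erase i) := by
      intro j
      have h2 : insert (i : α) (Set.range fun r => (t r : α))
          = Subtype.val '' ((insert i (Finset.univ.image t) : Finset H.vertexSet) :
              Set H.vertexSet) := by
        ext a
        simp only [Set.mem_insert_iff, Set.mem_range, Finset.coe_insert, Finset.coe_image,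
          Finset.coe_univ, Set.image_univ, Set.mem_image]
        constructor
        · rintro (rfl | ⟨r, rfl⟩)
          · exact ⟨i, Or.inl rfl, rfl⟩
          · exact ⟨t r, Or.inr ⟨r, rfl⟩, rfl⟩
        · rintro ⟨b, (rfl | ⟨r, rfl⟩), rfl⟩
          · exact Or.inl rfl
          · exact Or.inr ⟨r, rfl⟩
      rw [h2, (Set.image_injective.2 Subtype.val_injective).eq_iff, Finset.coe_inj]
      constructor
      · intro h
        have hi : i ∈ e j := h ▸ Finset.mem_insert_self _ _
        refine ⟨hi, ?_⟩
        have hsub : (e j).erase i ⊆ Finset.univ.image t := by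
          rw [← h]
          exact Finset.erase_insert_subset _ _
        symm
        -- The image of t has at most n elements, and e_j without i has exactly n, so t can neither
        -- repeat a vertex nor hit i.
        apply Finset.eq_of_subset_of_card_le hsub
        rw [Finset.card_erase_of_mem hi, hc, Nat.add_sub_cancel]
        exact Finset.card_image_le.trans (by simp)
      · rintro ⟨hi, h⟩
        rw [h, Finset.insert_erase hi]
    by_cases hmem : insert (i : α) (Set.range fun r => (t r : α)) ∈ H.edgeSet
    · rw [show H.adjacencyTensor (n + 1) i t = 1 / (n.factorial : ℝ) from if_pos hmem]
      rw [hE] at hmem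
      obtain ⟨j, hj⟩ := hmem
      have hj' := (h1 j).1 hj.symm
      rw [Finset.sum_eq_single j]
      · rw [if_pos hj'.1, if_pos hj'.2]
      · intro j' _ hne
        by_cases hi : i ∈ e j'
        · rw [if_pos hi, if_neg, mul_zero]
          intro h
          apply hne
          apply he
          rw [← Finset.insert_erase hi, ← h, hj'.2, Finset.insert_erase hj'.1]
        · rw [if_neg hi]
      · simp
    · rw [show H.adjacencyTensor (n + 1) i t = 0 from if_neg hmem, zero_mul]
      symm
      apply Finset.sum_eq_zero
      intro j _
      by_cases hi : i ∈ e j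
      · rw [if_pos hi, if_neg, mul_zero]
        intro h
        apply hmem
        rw [hE]
        exact ⟨j, ((h1 j).2 ⟨hi, h⟩).symm⟩
      · rw [if_neg hi]
  change ∑ t : Fin n → H.vertexSet, H.adjacencyTensor (n + 1) i t * ∏ r, x (t r) = _
  rw [Finset.sum_congr rfl fun t _ => key t, Finset.sum_comm]
  refine Finset.sum_congr rfl fun j _ => ?_
  by_cases hi : i ∈ e j
  · simp only [if_pos hi]
    rw [← Finset.mul_sum, sum_ite_image_eq_prod _ (by rw [Finset.card_erase_of_mem hi, hc]; rfl)]
    have : (n.factorial : ℝ) ≠ 0 := by positivity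
    field_simp
  · simp [hi]

open Classical in
theorem degree_eq_sum (e : ι → Finset H.vertexSet) (he : Function.Injective e)
    (hE : H.edgeSet = Set.range fun j => Subtype.val '' (e j : Set H.vertexSet))
    (i : H.vertexSet) :
    (H.degree (i : α) : ℝ) = ∑ j, if i ∈ e j then 1 else 0 := by
  have h : {s : Set α | s ∈ H.edgeSet ∧ (i : α) ∈ s}
      = (fun j => Subtype.val '' (e j : Set H.vertexSet)) ''
        ((Finset.univ.filter fun j => i ∈ e j : Finset ι) : Set ι) := by
    ext s
    rw [hE]
    simp only [Set.mem_ofPred_eq, Set.mem_range, Set.mem_image, Finset.coe_filter,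
      Finset.mem_univ, true_and]
    constructor
    · rintro ⟨⟨j, rfl⟩, h⟩
      exact ⟨j, by simpa using h, rfl⟩
    · rintro ⟨j, h, rfl⟩
      exact ⟨⟨j, rfl⟩, by simpa using h⟩
  rw [degree, h, Set.ncard_image_of_injective, Set.ncard_coe_finset, Finset.sum_boole]
  intro j j' hjj
  exact he (Finset.coe_injective (Set.image_injective.2 Subtype.val_injective hjj))

open Classical in
theorem isHEigenvalue_laplacianTensor_iff [Fintype H.vertexSet] {n : ℕ}
    (e : ι → Finset H.vertexSet) (he : Function.Injective e) (hc : ∀ j, (e j).card = n + 1)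
    (hE : H.edgeSet = Set.range fun j => Subtype.val '' (e j : Set H.vertexSet)) (l : ℝ) :
    (H.laplacianTensor (n + 1)).IsHEigenvalue l ↔ ∃ x : H.vertexSet → ℝ, x ≠ 0 ∧
      ∀ i, l * x i ^ n =
        ∑ j, if i ∈ e j then x i ^ n - ∏ v ∈ (e j).erase i, x v else 0 := by
  unfold RealTensor.IsHEigenvalue laplacianTensor RealTensor.identity
  refine exists_congr fun x => and_congr_right fun _ => ?_
  rw [funext_iff]
  refine forall_congr' fun i => ?_
  rw [RealTensor.applyVec_sub, RealTensor.applyVec_sub, RealTensor.applyVec_smul]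
  simp only [Pi.sub_apply, Pi.smul_apply, RealTensor.applyVec_diagonal, Pi.zero_apply,
    adjacencyTensor_applyVec e he hc hE, degree_eq_sum e he hE, smul_eq_mul, one_mul]
  rw [sub_eq_zero, Nat.add_sub_cancel, Finset.sum_mul, ← Finset.sum_sub_distrib]
  have : ∀ j, ((if i ∈ e j then (1 : ℝ) else 0) * x i ^ n -
      if i ∈ e j then ∏ v ∈ (e j).erase i, x v else 0)
      = if i ∈ e j then x i ^ n - ∏ v ∈ (e j).erase i, x v else 0 := by
    intro j
    split_ifs <;> ring
  simp only [this]

end Hypergraph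

/-! ### Loose paths as intervals of natural numbers -/

namespace Hypergraph

theorem IsLoosePath.isHEigenvalue_laplacianTensor_iff {α : Type*} {G : Hypergraph α}
    [Fintype G.vertexSet] {n d : ℕ} (hn : 0 < n) (hG : G.IsLoosePath (n + 1) d) (l : ℝ) :
    (G.laplacianTensor (n + 1)).IsHEigenvalue l ↔ ∃ y : ℕ → ℝ, (∃ m ≤ d * n, y m ≠ 0) ∧
      ∀ m ≤ d * n, l * y m ^ n = ∑ j : Fin d,
        if m ∈ Finset.Icc ((j : ℕ) * n) (((j : ℕ) + 1) * n) then
          y m ^ n - ∏ i ∈ (Finset.Icc ((j : ℕ) * n) (((j : ℕ) + 1) * n)).erase m, y i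
        else 0 := by
  classical
  obtain ⟨-, -, f, hf⟩ := hG
  change Fin (d * n + 1) ≃ G.vertexSet at f
  change G.edgeSet = Set.range (fun j : Fin d =>
      (fun m => (f m : α)) '' {m : Fin (d * n + 1) |
        (j : ℕ) * n ≤ (m : ℕ) ∧ (m : ℕ) ≤ ((j : ℕ) + 1) * n}) at hf
  -- `Fin.ofNat` wraps around modulo d * n + 1; g is only used on m ≤ d * n, where it agrees with f.
  set g : ℕ → G.vertexSet := fun m => f (Fin.ofNat (d * n + 1) m) with hg
  have hgf : ∀ m (hm : m ≤ d * n), g m = f ⟨m, by omega⟩ := by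
    intro m hm
    simp only [hg]
    congr 1
    ext
    simp only [Fin.val_ofNat]
    exact Nat.mod_eq_of_lt (by omega)
  have hgfin : ∀ m : Fin (d * n + 1), g m = f m := fun m => hgf m (by omega)
  have ginj : Set.InjOn g {m | m ≤ d * n} := by
    intro a ha b hb h
    rw [hgf a ha, hgf b hb] at h
    simpa using f.injective h
  have hle : ∀ j : Fin d, ((j : ℕ) + 1) * n ≤ d * n := fun j => Nat.mul_le_mul_right n j.2
  set B : Fin d → Finset ℕ := fun j => Finset.Icc ((j : ℕ) * n) (((j : ℕ) + 1) * n) with hB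
  have hBsub : ∀ j, (B j : Set ℕ) ⊆ {m | m ≤ d * n} := by
    intro j m hm
    simp only [hB, Finset.coe_Icc, Set.mem_Icc] at hm
    exact hm.2.trans (hle j)
  set e : Fin d → Finset G.vertexSet := fun j => (B j).image g with hedef
  have hmem : ∀ m ≤ d * n, ∀ j, g m ∈ e j ↔ m ∈ B j := by
    intro m hm j
    simp only [hedef, Finset.mem_image]
    constructor
    · rintro ⟨m', hm', h⟩
      rwa [← ginj (hBsub j hm') hm h]
    · intro h
      exact ⟨m, h, rfl⟩
  have he : Function.Injective e := by
    intro j j' h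
    -- The left endpoint of block i can lie in block i' only if i' ≤ i.
    have key : ∀ i i' : Fin d, e i = e i' → (i' : ℕ) ≤ i := by
      intro i i' h
      have h1 : (i : ℕ) * n ∈ B i := by
        simp only [hB, Finset.mem_Icc]
        exact ⟨le_rfl, Nat.mul_le_mul_right n (Nat.le_succ _)⟩
      have h2 : (i : ℕ) * n ∈ B i' := by
        rw [← hmem _ (hBsub i h1), ← h, hmem _ (hBsub i h1)]
        exact h1
      exact Nat.le_of_mul_le_mul_right (Finset.mem_Icc.1 h2).1 hn
    exact Fin.ext (le_antisymm (key _ _ h.symm) (key _ _ h))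
  have hc : ∀ j, (e j).card = n + 1 := by
    intro j
    rw [hedef, Finset.card_image_of_injOn (ginj.mono (hBsub j))]
    simp only [hB, Nat.card_Icc, add_mul, one_mul]
    omega
  have hE : G.edgeSet = Set.range fun j => Subtype.val '' (e j : Set G.vertexSet) := by
    rw [hf]
    congr 1
    ext j a
    simp only [Set.mem_image, Set.mem_ofPred_eq, hedef, Finset.coe_image, hB, Finset.coe_Icc,
      Set.mem_Icc]
    constructor
    · rintro ⟨m, hm, rfl⟩
      exact ⟨f m, ⟨m, hm, hgfin m⟩, rfl⟩
    · rintro ⟨_, ⟨m, hm, rfl⟩, rfl⟩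
      have := hm.2.trans (hle j)
      exact ⟨⟨m, by omega⟩, hm, by rw [hgf m this]⟩
  have hsurj : ∀ v, ∃ m ≤ d * n, g m = v := by
    intro v
    refine ⟨f.symm v, by omega, ?_⟩
    rw [hgfin, Equiv.apply_symm_apply]
  have heq : ∀ x : G.vertexSet → ℝ, ∀ m ≤ d * n,
      (∑ j, if g m ∈ e j then x (g m) ^ n - ∏ v ∈ (e j).erase (g m), x v else 0)
      = ∑ j, if m ∈ B j then x (g m) ^ n - ∏ i ∈ (B j).erase m, x (g i) else 0 := by
    intro x m hm
    refine Finset.sum_congr rfl fun j _ => ?_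
    by_cases h : m ∈ B j
    · rw [if_pos h, if_pos ((hmem m hm j).2 h)]
      have : (e j).erase (g m) = ((B j).erase m).image g := by
        ext v
        simp only [Finset.mem_erase, Finset.mem_image, hedef]
        constructor
        · rintro ⟨hne, i, hi, rfl⟩
          exact ⟨i, ⟨fun h => hne (by rw [h]), hi⟩, rfl⟩
        · rintro ⟨i, ⟨hne, hi⟩, rfl⟩
          exact ⟨fun h => hne (ginj (hBsub j hi) hm h), i, hi, rfl⟩
      rw [this, Finset.prod_image]
      intro a ha b hb
      exact ginj (hBsub j (Finset.mem_of_mem_erase ha)) (hBsub j (Finset.mem_of_mem_erase hb))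
    · rw [if_neg h, if_neg fun h' => h ((hmem m hm j).1 h')]
  rw [G.isHEigenvalue_laplacianTensor_iff e he hc hE]
  constructor
  · rintro ⟨x, hx, h⟩
    refine ⟨fun m => x (g m), ?_, ?_⟩
    · obtain ⟨v, hv⟩ := Function.ne_iff.1 hx
      obtain ⟨m, hm, rfl⟩ := hsurj v
      exact ⟨m, hm, hv⟩
    · intro m hm
      rw [← heq x m hm]
      exact h (g m)
  · rintro ⟨y, ⟨m, hm, hy⟩, h⟩
    obtain ⟨x, hxy⟩ : ∃ x : G.vertexSet → ℝ, ∀ m ≤ d * n, x (g m) = y m :=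
      ⟨fun v => y (f.symm v), fun m hm => by simp [hgf m hm]⟩
    refine ⟨x, ?_, ?_⟩
    · refine Function.ne_iff.2 ⟨g m, ?_⟩
      rw [hxy m hm]
      exact hy
    · intro v
      obtain ⟨m, hm, rfl⟩ := hsurj v
      rw [heq _ m hm, hxy m hm, h m hm]
      refine Finset.sum_congr rfl fun j _ => ?_
      by_cases hj : m ∈ B j
      · rw [if_pos hj, if_pos hj]
        congr 1
        exact Finset.prod_congr rfl fun i hi =>
          (hxy i (hBsub j (Finset.mem_of_mem_erase hi))).symm
      · rw [if_neg hj, if_neg hj]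

end Hypergraph

/-! ### Reduction to five unknowns -/

section LoosePathSystem

theorem prod_insert_erase_of_const {ι : Type*} [DecidableEq ι] {C : Finset ι} {p m : ι} {y : ι → ℝ}
    {a : ℝ} (hp : p ∉ C) (ha : ∀ i ∈ C, y i = a) (hm : m ∈ C) :
    ∏ i ∈ (insert p C).erase m, y i = y p * a ^ (C.card - 1) := by
  rw [Finset.erase_insert_of_ne (ne_of_mem_of_not_mem hm hp).symm,
    Finset.prod_insert (fun h => hp (Finset.mem_of_mem_erase h)),
    Finset.prod_eq_pow_card fun i hi => ha i (Finset.mem_of_mem_erase hi),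
    Finset.card_erase_of_mem hm]

theorem prod_insert_insert_erase_of_const {ι : Type*} [DecidableEq ι] {C : Finset ι} {p q m : ι}
    {y : ι → ℝ} {a : ℝ} (hpq : p ≠ q) (hp : p ∉ C) (hq : q ∉ C) (ha : ∀ i ∈ C, y i = a)
    (hm : m ∈ C) :
    ∏ i ∈ (insert p (insert q C)).erase m, y i = y p * (y q * a ^ (C.card - 1)) := by
  rw [Finset.erase_insert_of_ne (ne_of_mem_of_not_mem hm hp).symm, Finset.prod_insert,
    prod_insert_erase_of_const hq ha hm]
  intro h
  rcases Finset.mem_insert.1 (Finset.mem_of_mem_erase h) with h | h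
  · exact hpq h
  · exact hp h

/-- The equations satisfied by a vector that takes the value `a`, `b`, `c` at the vertices of
degree one in the first, second, third edge, and the values `u`, `v` at the vertices of degree
two. -/
def LoosePathSystem (n : ℕ) (l a u b v c : ℝ) : Prop :=
  (1 - l) * a ^ n = u * a ^ (n - 1) ∧
  (2 - l) * u ^ n = a ^ n + v * b ^ (n - 1) ∧
  (1 - l) * b ^ n = u * (v * b ^ (n - 2)) ∧
  (2 - l) * v ^ n = u * b ^ (n - 1) + c ^ n ∧
  (1 - l) * c ^ n = v * c ^ (n - 1)

/-- The eigenvalue equations of the loose path of length three, with vertices `0, ..., 3 n`. -/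
def LoosePathEquations (n : ℕ) (l : ℝ) (y : ℕ → ℝ) : Prop :=
  ∀ m ≤ 3 * n, l * y m ^ n = ∑ j : Fin 3,
        if m ∈ Finset.Icc ((j : ℕ) * n) (((j : ℕ) + 1) * n) then
          y m ^ n - ∏ i ∈ (Finset.Icc ((j : ℕ) * n) (((j : ℕ) + 1) * n)).erase m, y i
        else 0

variable {n : ℕ} {l : ℝ} {y : ℕ → ℝ}

theorem loosePathEquations_iff (hn : 2 ≤ n) : LoosePathEquations n l y ↔
    (∀ m < n, (1 - l) * y m ^ n = ∏ i ∈ (Finset.Icc 0 n).erase m, y i) ∧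
    (2 - l) * y n ^ n = ∏ i ∈ (Finset.Icc 0 n).erase n, y i +
      ∏ i ∈ (Finset.Icc n (2 * n)).erase n, y i ∧
    (∀ m, n < m → m < 2 * n →
      (1 - l) * y m ^ n = ∏ i ∈ (Finset.Icc n (2 * n)).erase m, y i) ∧
    (2 - l) * y (2 * n) ^ n = ∏ i ∈ (Finset.Icc n (2 * n)).erase (2 * n), y i +
      ∏ i ∈ (Finset.Icc (2 * n) (3 * n)).erase (2 * n), y i ∧
    (∀ m, 2 * n < m → m ≤ 3 * n →
      (1 - l) * y m ^ n = ∏ i ∈ (Finset.Icc (2 * n) (3 * n)).erase m, y i) := by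
  have key : ∀ m, (∑ j : Fin 3,
        if m ∈ Finset.Icc ((j : ℕ) * n) (((j : ℕ) + 1) * n) then
          y m ^ n - ∏ i ∈ (Finset.Icc ((j : ℕ) * n) (((j : ℕ) + 1) * n)).erase m, y i
        else 0) =
      (if m ≤ n then y m ^ n - ∏ i ∈ (Finset.Icc 0 n).erase m, y i else 0) +
      (if n ≤ m ∧ m ≤ 2 * n then
        y m ^ n - ∏ i ∈ (Finset.Icc n (2 * n)).erase m, y i else 0) +
      (if 2 * n ≤ m ∧ m ≤ 3 * n then
        y m ^ n - ∏ i ∈ (Finset.Icc (2 * n) (3 * n)).erase m, y i else 0) := by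
    intro m
    simp [Fin.sum_univ_three, one_add_one_eq_two, show (2 : ℕ) + 1 = 3 from rfl]
  unfold LoosePathEquations
  simp only [key]
  constructor
  · intro h
    refine ⟨fun m hm => ?_, ?_, fun m hm hm' => ?_, ?_, fun m hm hm' => ?_⟩
    · have := h m (by omega)
      rw [if_pos (by omega), if_neg (by omega), if_neg (by omega)] at this
      linarith
    · have := h n (by omega)
      rw [if_pos (by omega), if_pos (by omega), if_neg (by omega)] at this
      linarith
    · have := h m (by omega)
      rw [if_neg (by omega), if_pos (by omega), if_neg (by omega)] at this
      linarith
    · have := h (2 * n) (by omega)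
      rw [if_neg (by omega), if_pos (by omega), if_pos (by omega)] at this
      linarith
    · have := h m (by omega)
      rw [if_neg (by omega), if_neg (by omega), if_pos (by omega)] at this
      linarith
  · rintro ⟨h1, h2, h3, h4, h5⟩ m hm
    rcases lt_trichotomy m n with h | rfl | h
    · rw [if_pos (by omega), if_neg (by omega), if_neg (by omega)]
      linarith [h1 m h]
    · rw [if_pos (by omega), if_pos (by omega), if_neg (by omega)]
      linarith
    · rcases lt_trichotomy m (2 * n) with h' | rfl | h'
      · rw [if_neg (by omega), if_pos (by omega), if_neg (by omega)]
        linarith [h3 m h h']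
      · rw [if_neg (by omega), if_pos (by omega), if_pos (by omega)]
        linarith
      · rw [if_neg (by omega), if_neg (by omega), if_pos (by omega)]
        linarith [h5 m h' hm]

theorem loosePathEquations_iff_of_const (hn : 2 ≤ n) {a b c : ℝ} (ha : ∀ m < n, y m = a)
    (hb : ∀ m, n < m → m < 2 * n → y m = b) (hc : ∀ m, 2 * n < m → m ≤ 3 * n → y m = c) :
    LoosePathEquations n l y ↔ LoosePathSystem n l a (y n) b (y (2 * n)) c := by
  have e1 : Finset.Icc 0 n = insert n (Finset.Ico 0 n) := by
    ext i; simp only [Finset.mem_insert, Finset.mem_Icc, Finset.mem_Ico]; omega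
  have e2 : Finset.Icc n (2 * n) = insert n (insert (2 * n) (Finset.Ioo n (2 * n))) := by
    ext i; simp only [Finset.mem_insert, Finset.mem_Icc, Finset.mem_Ioo]; omega
  have e2' : Finset.Icc n (2 * n) = insert (2 * n) (insert n (Finset.Ioo n (2 * n))) := by
    rw [e2, Finset.insert_comm]
  have e3 : Finset.Icc (2 * n) (3 * n) = insert (2 * n) (Finset.Ioc (2 * n) (3 * n)) := by
    ext i; simp only [Finset.mem_insert, Finset.mem_Icc, Finset.mem_Ioc]; omega
  have c1 : (Finset.Ico 0 n).card = n := by simp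
  have c2 : (Finset.Ioo n (2 * n)).card = n - 1 := by simp; omega
  have c3 : (Finset.Ioc (2 * n) (3 * n)).card = n := by simp; omega
  have k1 : ∀ i ∈ Finset.Ico 0 n, y i = a := fun i hi => ha i (Finset.mem_Ico.1 hi).2
  have k2 : ∀ i ∈ Finset.Ioo n (2 * n), y i = b := fun i hi =>
    hb i (Finset.mem_Ioo.1 hi).1 (Finset.mem_Ioo.1 hi).2
  have k3 : ∀ i ∈ Finset.Ioc (2 * n) (3 * n), y i = c := fun i hi =>
    hc i (Finset.mem_Ioc.1 hi).1 (Finset.mem_Ioc.1 hi).2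
  have q1 : ∏ i ∈ (Finset.Icc 0 n).erase n, y i = a ^ n := by
    rw [e1, Finset.erase_insert (by simp), Finset.prod_eq_pow_card k1, c1]
  have q2 : ∏ i ∈ (Finset.Icc n (2 * n)).erase n, y i = y (2 * n) * b ^ (n - 1) := by
    rw [e2, Finset.erase_insert (by simp; omega), Finset.prod_insert (by simp),
      Finset.prod_eq_pow_card k2, c2]
  have q3 : ∏ i ∈ (Finset.Icc n (2 * n)).erase (2 * n), y i = y n * b ^ (n - 1) := by
    rw [e2', Finset.erase_insert (by simp; omega), Finset.prod_insert (by simp),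
      Finset.prod_eq_pow_card k2, c2]
  have q4 : ∏ i ∈ (Finset.Icc (2 * n) (3 * n)).erase (2 * n), y i = c ^ n := by
    rw [e3, Finset.erase_insert (by simp), Finset.prod_eq_pow_card k3, c3]
  have r1 : ∀ m < n, ∏ i ∈ (Finset.Icc 0 n).erase m, y i = y n * a ^ (n - 1) := by
    intro m hm
    rw [e1, prod_insert_erase_of_const (by simp) k1 (by simp [hm]), c1]
  have r2 : ∀ m, n < m → m < 2 * n → ∏ i ∈ (Finset.Icc n (2 * n)).erase m, y i =
      y n * (y (2 * n) * b ^ (n - 2)) := by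
    intro m hm hm'
    rw [e2, prod_insert_insert_erase_of_const (by omega) (by simp) (by simp) k2
      (by simp [hm, hm']), c2, Nat.sub_sub]
  have r3 : ∀ m, 2 * n < m → m ≤ 3 * n → ∏ i ∈ (Finset.Icc (2 * n) (3 * n)).erase m, y i =
      y (2 * n) * c ^ (n - 1) := by
    intro m hm hm'
    rw [e3, prod_insert_erase_of_const (by simp) k3 (by simp [hm, hm']), c3]
  rw [loosePathEquations_iff hn, q1, q2, q3, q4]
  refine and_congr ?_ (and_congr Iff.rfl (and_congr ?_ (and_congr Iff.rfl ?_)))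
  · constructor
    · intro h
      rw [← ha 0 (by omega), h 0 (by omega), r1 0 (by omega), ha 0 (by omega)]
    · intro h m hm
      rw [r1 m hm, ha m hm, h]
  · constructor
    · intro h
      rw [← hb (n + 1) (by omega) (by omega), h (n + 1) (by omega) (by omega),
        r2 (n + 1) (by omega) (by omega), hb (n + 1) (by omega) (by omega)]
    · intro h m hm hm'
      rw [r2 m hm hm', hb m hm hm', h]
  · constructor
    · intro h
      rw [← hc (3 * n) (by omega) (by omega), h (3 * n) (by omega) (by omega),
        r3 (3 * n) (by omega) (by omega), hc (3 * n) (by omega) (by omega)]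
    · intro h m hm hm'
      rw [r3 m hm hm', hc m hm hm', h]

/-- Any nonzero solution of the reduced system extends to a nonzero eigenvector. -/
theorem exists_loosePathEquations_of_system (hn : 2 ≤ n) {a u b v c : ℝ}
    (hne : a ≠ 0 ∨ u ≠ 0 ∨ b ≠ 0 ∨ v ≠ 0 ∨ c ≠ 0) (h : LoosePathSystem n l a u b v c) :
    ∃ y : ℕ → ℝ, (∃ m ≤ 3 * n, y m ≠ 0) ∧ LoosePathEquations n l y := by
  set y : ℕ → ℝ := fun m => if m < n then a else if m = n then u else if m < 2 * n then b
    else if m = 2 * n then v else c with hy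
  have ha : ∀ m < n, y m = a := fun m hm => if_pos hm
  have hu : y n = u := by simp [hy]
  have hb : ∀ m, n < m → m < 2 * n → y m = b := by
    intro m h1 h2
    simp only [hy]
    rw [if_neg (by omega), if_neg (by omega), if_pos h2]
  have hv : y (2 * n) = v := by
    simp only [hy]
    rw [if_neg (by omega), if_neg (by omega), if_neg (by omega)]
    exact if_pos trivial
  have hc : ∀ m, 2 * n < m → m ≤ 3 * n → y m = c := by
    intro m h1 h2
    simp only [hy]
    rw [if_neg (by omega), if_neg (by omega), if_neg (by omega), if_neg (by omega)]
  refine ⟨y, ?_, ?_⟩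
  · rcases hne with h | h | h | h | h
    · exact ⟨0, by omega, by rwa [ha 0 (by omega)]⟩
    · exact ⟨n, by omega, by rwa [hu]⟩
    · exact ⟨n + 1, by omega, by rwa [hb (n + 1) (by omega) (by omega)]⟩
    · exact ⟨2 * n, by omega, by rwa [hv]⟩
    · exact ⟨3 * n, by omega, by rwa [hc (3 * n) (by omega) (by omega)]⟩
  · rw [loosePathEquations_iff_of_const hn ha hb hc, hu, hv]
    exact h

/-- For even `n` and `l ≠ 1` the vertices of degree one in an edge have equal coordinates. -/
theorem exists_system_of_loosePathEquations (hn : 2 ≤ n) (he : Even n) (hl : l ≠ 1)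
    (h0 : ∃ m ≤ 3 * n, y m ≠ 0) (h : LoosePathEquations n l y) :
    ∃ a u b v c, (a ≠ 0 ∨ u ≠ 0 ∨ b ≠ 0 ∨ v ≠ 0 ∨ c ≠ 0) ∧ LoosePathSystem n l a u b v c := by
  have hl' : 1 - l ≠ 0 := sub_ne_zero.2 hl.symm
  -- Here parity enters: n + 1 is odd, so this power is injective on all of ℝ.
  have inj : Function.Injective fun t : ℝ => t ^ (n + 1) := he.add_one.strictMono_pow.injective
  -- Multiplying the equation at p by y p makes the right side the full edge product, which does not
  -- depend on p.
  have core : ∀ {s : Finset ℕ} {p q : ℕ}, p ∈ s → q ∈ s →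
      (1 - l) * y p ^ n = ∏ i ∈ s.erase p, y i → (1 - l) * y q ^ n = ∏ i ∈ s.erase q, y i →
      y p = y q := by
    intro s p q hp hq h1 h2
    apply inj
    apply mul_left_cancel₀ hl'
    simp only [pow_succ]
    rw [← mul_assoc, ← mul_assoc, h1, h2, Finset.prod_erase_mul _ _ hp,
      Finset.prod_erase_mul _ _ hq]
  obtain ⟨h1, -, h3, -, h5⟩ := (loosePathEquations_iff hn).1 h
  have ha : ∀ m < n, y m = y 0 := fun m hm =>
    core (s := Finset.Icc 0 n) (by simp; omega) (by simp) (h1 m hm) (h1 0 (by omega))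
  have hb : ∀ m, n < m → m < 2 * n → y m = y (n + 1) := fun m hm hm' =>
    core (s := Finset.Icc n (2 * n)) (by simp; omega) (by simp; omega) (h3 m hm hm')
      (h3 (n + 1) (by omega) (by omega))
  have hc : ∀ m, 2 * n < m → m ≤ 3 * n → y m = y (3 * n) := fun m hm hm' =>
    core (s := Finset.Icc (2 * n) (3 * n)) (by simp; omega) (by simp; omega) (h5 m hm hm')
      (h5 (3 * n) (by omega) (by omega))
  refine ⟨y 0, y n, y (n + 1), y (2 * n), y (3 * n), ?_,
    (loosePathEquations_iff_of_const hn ha hb hc).1 h⟩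
  obtain ⟨m, hm, hy⟩ := h0
  rcases lt_trichotomy m n with h | rfl | h
  · exact Or.inl (ha m h ▸ hy)
  · exact Or.inr (Or.inl hy)
  · rcases lt_trichotomy m (2 * n) with h' | rfl | h'
    · exact Or.inr (Or.inr (Or.inl (hb m h h' ▸ hy)))
    · exact Or.inr (Or.inr (Or.inr (Or.inl hy)))
    · exact Or.inr (Or.inr (Or.inr (Or.inr (hc m h' hm ▸ hy))))

end LoosePathSystem

/-! ### Solving the reduced system -/

section ReducedSystem

/-- The equations at an end edge when the core values of the middle edge vanish. -/
theorem eq_zero_or_of_end_edge {n : ℕ} {μ a u : ℝ} (hn : n ≠ 0)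
    (h1 : μ * a ^ n = u * a ^ (n - 1)) (h2 : (1 + μ) * u ^ n = a ^ n) :
    (a = 0 ∧ u = 0) ∨ 1 + μ = 0 ∨ (1 + μ) * μ ^ n = 1 := by
  by_cases ha : a = 0
  · subst ha
    rw [zero_pow hn] at h2
    rcases mul_eq_zero.1 h2 with h | h
    · exact Or.inr (Or.inl h)
    · exact Or.inl ⟨rfl, pow_eq_zero_iff hn |>.1 h⟩
  · right; right
    obtain ⟨p, rfl⟩ := Nat.exists_eq_succ_of_ne_zero hn
    have hu : u = μ * a := by
      apply mul_right_cancel₀ (pow_ne_zero p ha)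
      rw [Nat.succ_eq_add_one, Nat.add_sub_cancel] at h1
      rw [← h1]; ring
    rw [hu, mul_pow] at h2
    apply mul_right_cancel₀ (pow_ne_zero (p + 1) ha)
    rw [one_mul, mul_assoc]
    exact h2

/-- The contribution of an end edge next to a middle edge with nonzero core value `b`. -/
theorem end_edge_cases {p : ℕ} {μ a b u v : ℝ}
    (h1 : μ * a ^ (p + 2) = u * a ^ (p + 1))
    (h2 : (1 + μ) * u ^ (p + 2) = a ^ (p + 2) + v * b ^ (p + 1)) (hb : u * v = μ * b ^ 2) :
    (1 + μ) * u ^ (p + 3) = μ * b ^ (p + 3) ∨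
      ((1 + μ) * μ ^ (p + 2) - 1) * u ^ (p + 3) = μ ^ (p + 3) * b ^ (p + 3) := by
  -- Multiplying by u lets u v = μ b² eliminate v.
  have h3 : (1 + μ) * u ^ (p + 3) = a ^ (p + 2) * u + μ * b ^ (p + 3) := by
    linear_combination u * h2 + b ^ (p + 1) * hb
  by_cases ha : a = 0
  · left
    rw [h3, ha]
    simp
  · right
    have hu : u = μ * a := by
      apply mul_right_cancel₀ (pow_ne_zero (p + 1) ha)
      rw [← h1]; ring
    have h4 : u ^ (p + 2) = μ ^ (p + 2) * a ^ (p + 2) := by rw [hu, mul_pow]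
    linear_combination μ ^ (p + 2) * h3 - u * h4

theorem cases_of_loosePathSystem {p : ℕ} {l a u b v c : ℝ} (hl : l ≠ 1)
    (hne : a ≠ 0 ∨ u ≠ 0 ∨ b ≠ 0 ∨ v ≠ 0 ∨ c ≠ 0)
    (h : LoosePathSystem (p + 2) l a u b v c) {μ : ℝ} (hμl : μ = 1 - l) :
    1 + μ = 0 ∨ (1 + μ) * μ ^ (p + 2) = 1 ∨ (1 + μ) ^ 2 * μ ^ (p + 1) = 1 ∨
      (1 + μ) ^ 2 * μ ^ (p + 2) = 1 + 2 * μ ∨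
      ((1 + μ) * μ ^ (p + 2) - 1) ^ 2 = μ ^ (p + 3) := by
  obtain ⟨h1, h2, h3, h4, h5⟩ := h
  have hμ : μ ≠ 0 := by rw [hμl]; exact sub_ne_zero.2 hl.symm
  rw [show 2 - l = 1 + μ by rw [hμl]; ring] at h2 h4
  rw [← hμl] at h1 h3 h5
  simp only [show p + 2 - 1 = p + 1 from rfl, show p + 2 - 2 = p from rfl] at h1 h2 h3 h4 h5
  by_cases hb : b = 0
  · subst hb
    simp only [zero_pow (Nat.succ_ne_zero p), mul_zero, add_zero, zero_add] at h2 h4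
    rcases eq_zero_or_of_end_edge (by omega) h1 h2 with ⟨rfl, rfl⟩ | h | h
    · rcases eq_zero_or_of_end_edge (by omega) h5 h4 with ⟨rfl, rfl⟩ | h | h
      · simp at hne
      · exact Or.inl h
      · exact Or.inr (Or.inl h)
    · exact Or.inl h
    · exact Or.inr (Or.inl h)
  · right; right
    have hb2 : u * v = μ * b ^ 2 := by
      apply mul_right_cancel₀ (pow_ne_zero p hb)
      linear_combination -h3
    have hb2' : v * u = μ * b ^ 2 := by rw [mul_comm, hb2]
    -- This relation is the coupling between the two ends once b ≠ 0.
    have hUV : u ^ (p + 3) * v ^ (p + 3) = μ ^ (p + 3) * (b ^ (p + 3)) ^ 2 := by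
      rw [← mul_pow, hb2, mul_pow]; ring
    have hB : (b ^ (p + 3)) ^ 2 ≠ 0 := pow_ne_zero _ (pow_ne_zero _ hb)
    have hμ2 : μ ^ 2 ≠ 0 := pow_ne_zero _ hμ
    have hμ3 : μ ^ (p + 3) ≠ 0 := pow_ne_zero _ hμ
    rw [add_comm (u * _)] at h4
    -- One end edge has zero value on its degree-one vertices and the other does not; stated for s,
    -- t to serve both orders.
    have mixed : ∀ {s t : ℝ}, s * t = μ ^ (p + 3) * (b ^ (p + 3)) ^ 2 →
        (1 + μ) * s = μ * b ^ (p + 3) →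
        ((1 + μ) * μ ^ (p + 2) - 1) * t = μ ^ (p + 3) * b ^ (p + 3) →
        (1 + μ) ^ 2 * μ ^ (p + 2) = 1 + 2 * μ := by
      intro s t hst hs ht
      have : ((1 + μ) * ((1 + μ) * μ ^ (p + 2) - 1)) * (s * t) =
          μ * (μ ^ (p + 3) * (b ^ (p + 3)) ^ 2) := by
        calc _ = ((1 + μ) * s) * (((1 + μ) * μ ^ (p + 2) - 1) * t) := by ring
          _ = _ := by rw [hs, ht]; ring
      rw [hst] at this
      have := mul_right_cancel₀ (mul_ne_zero hμ3 hB) this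
      linear_combination this
    rcases end_edge_cases h1 h2 hb2 with hu | hu <;>
      rcases end_edge_cases h5 h4 hb2' with hv | hv
    · left
      apply mul_right_cancel₀ (mul_ne_zero hμ2 hB)
      calc (1 + μ) ^ 2 * μ ^ (p + 1) * (μ ^ 2 * (b ^ (p + 3)) ^ 2)
          = (1 + μ) ^ 2 * (μ ^ (p + 3) * (b ^ (p + 3)) ^ 2) := by ring
        _ = ((1 + μ) * u ^ (p + 3)) * ((1 + μ) * v ^ (p + 3)) := by rw [← hUV]; ring
        _ = _ := by rw [hu, hv]; ring
    · exact Or.inr (Or.inl (mixed hUV hu hv))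
    · exact Or.inr (Or.inl (mixed (by rw [mul_comm, hUV]) hv hu))
    · right; right
      apply mul_right_cancel₀ (mul_ne_zero hμ3 hB)
      calc ((1 + μ) * μ ^ (p + 2) - 1) ^ 2 * (μ ^ (p + 3) * (b ^ (p + 3)) ^ 2)
          = (((1 + μ) * μ ^ (p + 2) - 1) * u ^ (p + 3)) *
            (((1 + μ) * μ ^ (p + 2) - 1) * v ^ (p + 3)) := by rw [← hUV]; ring
        _ = _ := by rw [hu, hv]; ring

variable {p : ℕ} {μ : ℝ}

theorem loosePathSystem_two : LoosePathSystem (p + 2) 2 0 1 0 0 0 := by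
  refine ⟨?_, ?_, ?_, ?_, ?_⟩ <;> simp

theorem loosePathSystem_one : LoosePathSystem (p + 2) 1 0 0 1 0 0 := by
  refine ⟨?_, ?_, ?_, ?_, ?_⟩ <;> simp

theorem loosePathSystem_one_end (h : (1 + μ) * μ ^ (p + 2) = 1) :
    LoosePathSystem (p + 2) (1 - μ) 1 μ 0 0 0 := by
  refine ⟨?_, ?_, ?_, ?_, ?_⟩ <;> simp
  linear_combination h

/-- An eigenvector supported on the middle edge: normalizing b = 1 forces u v = μ, and the symmetric
choice u = v = √μ works. -/
theorem loosePathSystem_middle (hμ : 0 < μ) (h : (1 + μ) ^ 2 * μ ^ (p + 1) = 1) :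
    LoosePathSystem (p + 2) (1 - μ) 0 (√μ) 1 (√μ) 0 := by
  have hs : √μ ^ 2 = μ := Real.sq_sqrt hμ.le
  have h' : (1 + μ) * √μ ^ (p + 1) = 1 := by
    have h1 : ((1 + μ) * √μ ^ (p + 1)) ^ 2 = 1 := by
      rw [mul_pow, ← pow_mul, mul_comm (p + 1) 2, pow_mul, hs, h]
    exact (pow_eq_one_iff_of_nonneg (by positivity) two_ne_zero).1 h1
  refine ⟨?_, ?_, ?_, ?_, ?_⟩ <;> simp
  · linear_combination √μ * h'
  · rw [← sq, hs]
  · linear_combination √μ * h'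

/-- With b = 1 and c = 0 the equation at v reads (1 + μ) v^k = μ, after which u = μ / v and a = u /
μ. Since μ may be negative, v has to be a real k-th root, available because k is odd. -/
theorem exists_loosePathSystem_middle_end (hp : Even p) (hμ : μ ≠ 0)
    (h : (1 + μ) ^ 2 * μ ^ (p + 2) = 1 + 2 * μ) :
    ∃ a u v, LoosePathSystem (p + 2) (1 - μ) a u 1 v 0 := by
  have h1 : 1 + μ ≠ 0 := by
    intro h0
    rw [h0] at h
    norm_num at h
    linarith
  obtain ⟨v, hv⟩ : ∃ v : ℝ, v ^ (p + 3) = μ / (1 + μ) := by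
    have hodd : Odd (p + 3) := by
      rw [show p + 3 = p + 2 + 1 from rfl]
      exact (hp.add even_two).add_one
    have hc : Continuous fun t : ℝ => t ^ (p + 3) := by fun_prop
    exact hc.surjective (Filter.tendsto_pow_atTop (by omega)) (by
      have h := (Filter.tendsto_pow_atTop (α := ℝ) (n := p + 3) (by omega)).comp
        Filter.tendsto_neg_atBot_atTop
      rw [← Filter.tendsto_neg_atTop_iff]
      exact h.congr fun t => hodd.neg_pow t) _
  have hv0 : v ≠ 0 := by
    rintro rfl
    rw [zero_pow (by omega)] at hv
    exact div_ne_zero hμ h1 hv.symm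
  have hv' : (1 + μ) * v ^ (p + 3) = μ := by rw [hv]; field_simp
  refine ⟨1 / v, μ / v, v, ?_, ?_, ?_, ?_, ?_⟩ <;> simp
  · field_simp
    ring
  · have h2 : (1 + μ) * μ ^ (p + 2) = 1 + v ^ (p + 3) := by
      apply mul_left_cancel₀ h1
      linear_combination h - hv'
    rw [div_pow]
    field_simp
    linear_combination h2
  · field_simp
  · field_simp
    linear_combination hv'

theorem exists_loosePathSystem_all (hp : Even p) (hμ : 0 < μ)
    (h : ((1 + μ) * μ ^ (p + 2) - 1) ^ 2 = μ ^ (p + 3)) :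
    ∃ a u v c, LoosePathSystem (p + 2) (1 - μ) a u 1 v c := by
  have hs : √μ ^ 2 = μ := Real.sq_sqrt hμ.le
  have hodd : Odd (p + 3) := by
    rw [show p + 3 = p + 2 + 1 from rfl]
    exact (hp.add even_two).add_one
  -- In the symmetric solution u = v = t with t² = μ, the joint equation becomes t^k = (1 + μ) μ^n -
  -- 1. The hypothesis gives this up to sign, and as k is odd the sign of t corrects it.
  obtain ⟨t, ht, htw⟩ : ∃ t : ℝ, t ^ 2 = μ ∧ t ^ (p + 3) = (1 + μ) * μ ^ (p + 2) - 1 := by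
    have h1 : ((1 + μ) * μ ^ (p + 2) - 1) ^ 2 = (√μ ^ (p + 3)) ^ 2 := by
      rw [h, ← pow_mul, mul_comm (p + 3) 2, pow_mul, hs]
    rcases sq_eq_sq_iff_eq_or_eq_neg.1 h1 with h2 | h2
    · exact ⟨√μ, hs, h2.symm⟩
    · exact ⟨-√μ, by rw [neg_sq, hs], by rw [hodd.neg_pow, h2]⟩
  have ht0 : t ≠ 0 := by
    rintro rfl
    norm_num at ht
    exact hμ.ne ht
  have hpow : μ ^ (p + 2) = t ^ (p + 2) * t ^ (p + 2) := by
    rw [← ht, ← mul_pow, sq]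
  refine ⟨1 / t, t, t, 1 / t, ?_, ?_, ?_, ?_, ?_⟩ <;> simp
  · field_simp
    linear_combination -t ^ (p + 1) * ht
  · field_simp
    linear_combination (-1 : ℝ) * htw + (-1 - μ) * hpow
  · linear_combination -ht
  · field_simp
    linear_combination (-1 : ℝ) * htw + (-1 - μ) * hpow
  · field_simp
    linear_combination -t ^ (p + 1) * ht

end ReducedSystem

/-! ### Real roots of the equations in μ -/

section Roots

/-- Existence is the intermediate value theorem. Uniqueness asks only that two zeros cannot coexist,
because some comparisons below use the equations f x = 0 and f y = 0 themselves. -/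
theorem exists_unique_root {f : ℝ → ℝ} {r : ℝ} (hr : 0 ≤ r) (hc : Continuous f) (h0 : f 0 < 0)
    (h1 : 0 < f r) (hu : ∀ x y, 0 ≤ x → x < y → f x = 0 → f y ≠ 0) :
    ∃ m ∈ Set.Ioo 0 r, ∀ x, 0 ≤ x → (f x = 0 ↔ x = m) := by
  obtain ⟨m, hm, hfm⟩ := intermediate_value_Ioo hr hc.continuousOn (show (0 : ℝ) ∈ _ from ⟨h0, h1⟩)
  refine ⟨m, hm, fun x hx => ⟨fun h => ?_, fun h => h ▸ hfm⟩⟩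
  rcases lt_trichotomy x m with hlt | heq | hlt
  · exact absurd hfm (hu x m hx hlt h)
  · exact heq
  · exact absurd h (hu m x hm.1.le hlt hfm)

theorem exists_root_two {n : ℕ} (hn : n ≠ 0) (he : Even n) :
    ∃ m ∈ Set.Ioo (0 : ℝ) 1, ∀ x : ℝ, (1 + x) * x ^ n = 1 ↔ x = m := by
  obtain ⟨m, hm, h⟩ := exists_unique_root (f := fun x : ℝ => (1 + x) * x ^ n - 1) zero_le_one
    (by fun_prop) (by simp [hn]) (by norm_num) (by
      intro x y hx hxy h
      have h1 : x ^ n < y ^ n := pow_lt_pow_left₀ hxy hx hn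
      have h2 : 0 ≤ x ^ n := by positivity
      intro h'
      nlinarith)
  refine ⟨m, hm, fun x => ?_⟩
  rcases le_or_gt 0 x with hx | hx
  · rw [← h x hx, sub_eq_zero]
  · refine ⟨fun h' => ?_, fun h' => absurd hm.1 (by linarith)⟩
    -- For negative x, evenness of n makes 1 + x positive, hence |x| < 1 and (1 + x) x^n < 1.
    exfalso
    have h1 : 0 < x ^ n := he.pow_pos hx.ne
    have h2 : 0 < 1 + x := pos_of_mul_pos_left (by rw [h']; norm_num) h1.le
    have h3 : x ^ n ≤ 1 := by
      rw [← he.neg_pow]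
      exact pow_le_one₀ (by linarith) (by linarith)
    nlinarith

theorem exists_root_three {n : ℕ} (ho : Odd n) :
    ∃ m ∈ Set.Ioo (0 : ℝ) 1, ∀ x : ℝ, (1 + x) ^ 2 * x ^ n = 1 ↔ x = m := by
  have hn : n ≠ 0 := ho.pos.ne'
  obtain ⟨m, hm, h⟩ := exists_unique_root (f := fun x : ℝ => (1 + x) ^ 2 * x ^ n - 1) zero_le_one
    (by fun_prop) (by simp [hn]) (by norm_num) (by
      intro x y hx hxy h
      have h1 : x ^ n < y ^ n := pow_lt_pow_left₀ hxy hx hn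
      have h2 : (1 + x) ^ 2 < (1 + y) ^ 2 := pow_lt_pow_left₀ (by linarith) (by linarith) two_ne_zero
      have h3 := mul_lt_mul'' h2 h1 (by positivity) (by positivity)
      intro h'
      linarith)
  refine ⟨m, hm, fun x => ?_⟩
  rcases le_or_gt 0 x with hx | hx
  · rw [← h x hx, sub_eq_zero]
  · refine ⟨fun h' => ?_, fun h' => absurd hm.1 (by linarith)⟩
    exfalso
    have h1 : x ^ n < 0 := ho.pow_neg hx
    nlinarith [sq_nonneg (1 + x)]

/-- For x ≥ 0 write x^n = (1 + 2x) / (1 + x)²: the left side increases and the right side decreases.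
For x = -y < 0 the equation is (1 - y)² y^n = 1 - 2y, which forces y ≤ 1/2; there ((1 - y) y)²
y^(n-2) is nondecreasing and 1 - 2y strictly decreasing. -/
theorem exists_roots_four {n : ℕ} (hn : 2 ≤ n) (he : Even n) :
    ∃ m ∈ Set.Ioo (0 : ℝ) 1, ∃ r ∈ Set.Ioo (0 : ℝ) (1 / 2),
      ∀ x : ℝ, (1 + x) ^ 2 * x ^ n = 1 + 2 * x ↔ (x = m ∨ x = -r) := by
  have hn0 : n ≠ 0 := by omega
  obtain ⟨m, hm, h⟩ := exists_unique_root
    (f := fun x : ℝ => (1 + x) ^ 2 * x ^ n - (1 + 2 * x)) zero_le_one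
    (by fun_prop) (by simp [hn0]) (by norm_num) (by
      intro x y hx hxy h h'
      have h1 : x ^ n < y ^ n := pow_lt_pow_left₀ hxy hx hn0
      have h2 : (1 + x) ^ 2 * (1 + 2 * y) ≤ (1 + y) ^ 2 * (1 + 2 * x) := by
        nlinarith [mul_nonneg (sub_nonneg.2 hxy.le) (mul_nonneg hx (hx.trans hxy.le)),
          mul_nonneg (sub_nonneg.2 hxy.le) (add_nonneg hx (hx.trans hxy.le))]
      have h3 : (1 + x) ^ 2 * (1 + 2 * y) * x ^ n < (1 + y) ^ 2 * (1 + 2 * x) * y ^ n :=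
        mul_lt_mul' h2 h1 (by positivity) (by have := hx.trans_lt hxy; positivity)
      simp only [sub_eq_zero] at h h'
      have e1 : (1 + x) ^ 2 * (1 + 2 * y) * x ^ n = (1 + 2 * x) * (1 + 2 * y) := by
        rw [← h]; ring
      have e2 : (1 + y) ^ 2 * (1 + 2 * x) * y ^ n = (1 + 2 * x) * (1 + 2 * y) := by
        rw [← h']; ring
      linarith)
  obtain ⟨q, rfl⟩ : ∃ q, n = q + 2 := ⟨n - 2, by omega⟩
  obtain ⟨r, hr, h'⟩ := exists_unique_root
    (f := fun x : ℝ => (1 - x) ^ 2 * x ^ (q + 2) - (1 - 2 * x)) (r := 1 / 2) (by norm_num)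
    (by fun_prop) (by simp) (by norm_num) (by
      intro x y hx hxy h h'
      simp only [sub_eq_zero] at h h'
      have hy : y ≤ 1 / 2 := by
        have : 0 ≤ (1 - y) ^ 2 * y ^ (q + 2) := by
          have := hx.trans hxy.le
          positivity
        linarith
      have h1 : x ^ q ≤ y ^ q := pow_le_pow_left₀ hx hxy.le q
      have h2 : (1 - x) * x ≤ (1 - y) * y := by nlinarith
      have h3 : ((1 - x) * x) ^ 2 ≤ ((1 - y) * y) ^ 2 :=
        pow_le_pow_left₀ (mul_nonneg (by linarith) hx) h2 2
      have h4 : ((1 - x) * x) ^ 2 * x ^ q ≤ ((1 - y) * y) ^ 2 * y ^ q :=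
        mul_le_mul h3 h1 (by positivity) (by positivity)
      have e1 : ((1 - x) * x) ^ 2 * x ^ q = 1 - 2 * x := by rw [← h]; ring
      have e2 : ((1 - y) * y) ^ 2 * y ^ q = 1 - 2 * y := by rw [← h']; ring
      linarith)
  refine ⟨m, hm, r, hr, fun x => ?_⟩
  rcases le_or_gt 0 x with hx | hx
  · rw [← sub_eq_zero, h x hx]
    exact ⟨Or.inl, fun h => h.resolve_right fun h => by linarith [hr.1]⟩
  · have h2 := h' (-x) (by linarith)
    rw [he.neg_pow, sub_eq_zero] at h2
    rw [show (1 + x) ^ 2 * x ^ (q + 2) = (1 - -x) ^ 2 * x ^ (q + 2) by ring,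
      show 1 + 2 * x = 1 - 2 * -x by ring, h2]
    constructor
    · intro h
      exact Or.inr (by linarith)
    · rintro (h | h)
      · linarith [hm.1]
      · linarith

/-- On (0,1) only the negative square root is possible: if w = (1 + x) x^n - 1 were nonnegative,
then w < x^n, so w² < x^(2n) ≤ x^(n+1). The remaining equation w + √(x^(n+1)) = 0 has an increasing
left side. -/
theorem exists_root_five {n : ℕ} (hn : n ≠ 0) :
    ∃ m ∈ Set.Ioo (0 : ℝ) 1, ∀ x ∈ Set.Ioo (0 : ℝ) 1,
      (((1 + x) * x ^ n - 1) ^ 2 = x ^ (n + 1) ↔ x = m) := by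
  obtain ⟨m, hm, h⟩ := exists_unique_root
    (f := fun x : ℝ => (1 + x) * x ^ n - 1 + √(x ^ (n + 1))) zero_le_one
    (by fun_prop) (by simp [hn]) (by norm_num) (by
      intro x y hx hxy h
      have h1 : x ^ n < y ^ n := pow_lt_pow_left₀ hxy hx hn
      have h2 : 0 ≤ x ^ n := by positivity
      have h3 : √(x ^ (n + 1)) ≤ √(y ^ (n + 1)) :=
        Real.sqrt_le_sqrt (pow_le_pow_left₀ hx hxy.le _)
      intro h'
      nlinarith)
  refine ⟨m, hm, fun x hx => ?_⟩
  have hx0 := hx.1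
  have hp : 0 < x ^ (n + 1) := by positivity
  rw [← h x hx0.le]
  constructor
  · intro h1
    have h2 : ((1 + x) * x ^ n - 1) ^ 2 = √(x ^ (n + 1)) ^ 2 := by rw [h1, Real.sq_sqrt hp.le]
    rcases sq_eq_sq_iff_eq_or_eq_neg.1 h2 with h3 | h3
    · exfalso
      have h4 : 0 ≤ (1 + x) * x ^ n - 1 := h3 ▸ Real.sqrt_nonneg _
      have h5 : x ^ (n + 1) < 1 := pow_lt_one₀ hx0.le hx.2 (by omega)
      have h6 : (1 + x) * x ^ n - 1 < x ^ n := by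
        have : (1 + x) * x ^ n = x ^ n + x ^ (n + 1) := by ring
        linarith
      have h7 : ((1 + x) * x ^ n - 1) ^ 2 < (x ^ n) ^ 2 := pow_lt_pow_left₀ h6 h4 two_ne_zero
      have h8 : (x ^ n) ^ 2 ≤ x ^ (n + 1) := by
        rw [← pow_mul]
        exact pow_le_pow_of_le_one hx0.le hx.2.le (by omega)
      linarith
    · rw [h3]; ring
  · intro h1
    rw [show (1 + x) * x ^ n - 1 = -√(x ^ (n + 1)) by linarith, neg_sq, Real.sq_sqrt hp.le]

/-- An odd power equal to a square is nonnegative, and for x > 1 the base on the left is at least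
x^(n+1) > 1, so its square is too large. The endpoint x = 1 is a genuine root. -/
theorem mem_Ioc_of_root_five {n : ℕ} (he : Even n) {x : ℝ} (hx : x ≠ 0)
    (h : ((1 + x) * x ^ n - 1) ^ 2 = x ^ (n + 1)) : x ∈ Set.Ioc (0 : ℝ) 1 := by
  have h0 : 0 ≤ x := by
    have := he.add_one.pow_nonneg_iff.1 (h ▸ sq_nonneg _)
    exact this
  refine ⟨lt_of_le_of_ne h0 hx.symm, le_of_not_gt fun h1 => ?_⟩
  have h2 : 1 ≤ x ^ n := one_le_pow₀ h1.le
  have h3 : 1 < x ^ (n + 1) := one_lt_pow₀ h1 (by omega)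
  have h4 : x ^ (n + 1) ≤ (1 + x) * x ^ n - 1 := by
    have : (1 + x) * x ^ n = x ^ n + x ^ (n + 1) := by ring
    linarith
  nlinarith

end Roots

/-! ### Characterization and count of the H-eigenvalues -/

theorem Hypergraph.IsLoosePath.isHEigenvalue_laplacianTensor_iff_of_ne_zero {α : Type*}
    {G : Hypergraph α} [Fintype G.vertexSet] {p : ℕ} (hp : Even p) (hG : G.IsLoosePath (p + 3) 3)
    {μ : ℝ} (hμ : μ ≠ 0) : (G.laplacianTensor (p + 3)).IsHEigenvalue (1 - μ) ↔
      1 + μ = 0 ∨ (1 + μ) * μ ^ (p + 2) = 1 ∨ (1 + μ) ^ 2 * μ ^ (p + 1) = 1 ∨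
      (1 + μ) ^ 2 * μ ^ (p + 2) = 1 + 2 * μ ∨
      ((1 + μ) * μ ^ (p + 2) - 1) ^ 2 = μ ^ (p + 3) := by
  have hn : 2 ≤ p + 2 := by omega
  have hE := hG.isHEigenvalue_laplacianTensor_iff (n := p + 2) (by omega) (1 - μ)
  rw [hE]
  constructor
  · rintro ⟨y, h0, h⟩
    have hl : 1 - μ ≠ 1 := fun h => hμ (by linarith)
    obtain ⟨a, u, b, v, c, hne, hs⟩ :=
      exists_system_of_loosePathEquations hn (hp.add even_two) hl h0 h
    exact cases_of_loosePathSystem hl hne hs (by ring)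
  · rintro (h | h | h | h | h)
    · obtain rfl : μ = -1 := by linarith
      refine exists_loosePathEquations_of_system hn (a := 0) (u := 1) (b := 0) (v := 0) (c := 0)
        (by simp) ?_
      rw [show (1 : ℝ) - -1 = 2 by norm_num]
      exact loosePathSystem_two
    · exact exists_loosePathEquations_of_system hn (by simp) (loosePathSystem_one_end h)
    · have hμ0 : 0 < μ := by
        have ho : Odd (p + 1) := hp.add_one
        rw [← ho.pow_pos_iff]
        exact pos_of_mul_pos_right (h ▸ one_pos) (sq_nonneg _)
      exact exists_loosePathEquations_of_system hn (by simp) (loosePathSystem_middle hμ0 h)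
    · obtain ⟨a, u, v, hs⟩ := exists_loosePathSystem_middle_end hp hμ h
      exact exists_loosePathEquations_of_system hn (by simp) hs
    · obtain ⟨a, u, v, c, hs⟩ := exists_loosePathSystem_all hp
        (mem_Ioc_of_root_five (hp.add even_two) hμ h).1 h
      exact exists_loosePathEquations_of_system hn (by simp) hs

theorem Hypergraph.IsLoosePath.isHEigenvalue_laplacianTensor_one {α : Type*}
    {G : Hypergraph α} [Fintype G.vertexSet] {p : ℕ} (hG : G.IsLoosePath (p + 3) 3) :
    (G.laplacianTensor (p + 3)).IsHEigenvalue 1 :=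
  (hG.isHEigenvalue_laplacianTensor_iff (n := p + 2) (by omega) 1).2
    (exists_loosePathEquations_of_system (by omega) (by simp) loosePathSystem_one)

theorem ncard_insert_zero_insert_two {a b c d e : ℝ} (ha : a ∈ Set.Ioo (0 : ℝ) 1)
    (hb : b ∈ Set.Ioo (0 : ℝ) 1) (hc : c ∈ Set.Ioo (0 : ℝ) 1) (hd : d ∈ Set.Ioo (0 : ℝ) 1)
    (he : e ∈ Set.Ioo (1 : ℝ) 2) (hab : a ≠ b) (hac : a ≠ c) (had : a ≠ d) (hbc : b ≠ c)
    (hbd : b ≠ d) (hcd : c ≠ d) : ({0, 2, e, a, b, c, d} : Set ℝ).ncard = 7 := by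
  obtain ⟨ha0, ha1⟩ := ha
  obtain ⟨hb0, hb1⟩ := hb
  obtain ⟨hc0, hc1⟩ := hc
  obtain ⟨hd0, hd1⟩ := hd
  obtain ⟨he0, he1⟩ := he
  have h : ({0, 2, e, a, b, c, d} : Set ℝ) = (({0, 2, e, a, b, c, d} : Finset ℝ) : Set ℝ) := by
    push_cast
    rfl
  rw [h, Set.ncard_coe_finset, Finset.card_insert_of_notMem, Finset.card_insert_of_notMem,
    Finset.card_insert_of_notMem, Finset.card_insert_of_notMem, Finset.card_insert_of_notMem,
    Finset.card_insert_of_notMem, Finset.card_singleton]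
  · simpa using hcd
  · simpa using ⟨hbc, hbd⟩
  · simpa using ⟨hab, hac, had⟩
  · simp only [Finset.mem_insert, Finset.mem_singleton, not_or]
    refine ⟨?_, ?_, ?_, ?_⟩ <;> intro h <;> linarith
  · simp only [Finset.mem_insert, Finset.mem_singleton, not_or]
    refine ⟨?_, ?_, ?_, ?_, ?_⟩ <;> intro h <;> linarith
  · simp only [Finset.mem_insert, Finset.mem_singleton, not_or]
    refine ⟨?_, ?_, ?_, ?_, ?_, ?_⟩ <;> intro h <;> linarith

theorem mainTheorem1 {α : Type*} (k : ℕ) (hk : 3 ≤ k) (hodd : Odd k)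
    (G : Hypergraph α) [Fintype G.vertexSet] (hG : G.IsLoosePath k 3) :
    -- the characterization of the H-eigenvalues other than 1
    (∀ l : ℝ, (l ≠ 1 ∧ (G.laplacianTensor k).IsHEigenvalue l) ↔
      ((l = 0 ∨ l = 2) ∨
       (l ∈ Set.Ioo (0 : ℝ) 1 ∧ (l - 2) * (1 - l) ^ (k - 1) + 1 = 0) ∨
       (l ∈ Set.Ioo (0 : ℝ) 1 ∧ (l - 2) ^ 2 * (1 - l) ^ (k - 2) - 1 = 0) ∨
       ((l - 2) ^ 2 * (1 - l) ^ (k - 1) + 2 * l - 3 = 0) ∨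
       (l ∈ Set.Ioo (0 : ℝ) 1 ∧
          ((l - 2) * (l - 1) ^ (k - 1) + 1) ^ 2 - (1 - l) ^ k = 0))) ∧
    -- (ii) the equation has exactly one real root, and this root is in (0,1)
    (∃ a ∈ Set.Ioo (0 : ℝ) 1, ∀ l : ℝ, (l - 2) * (1 - l) ^ (k - 1) + 1 = 0 ↔ l = a) ∧
    -- (iii) the equation has exactly one real root, and this root is in (0,1)
    (∃ a ∈ Set.Ioo (0 : ℝ) 1, ∀ l : ℝ, (l - 2) ^ 2 * (1 - l) ^ (k - 2) - 1 = 0 ↔ l = a) ∧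
    -- (iv) the equation has exactly two real roots, one in (0,1) and one in (1, 2k/(k+1))
    (∃ a ∈ Set.Ioo (0 : ℝ) 1, ∃ b ∈ Set.Ioo (1 : ℝ) (2 * (k : ℝ) / ((k : ℝ) + 1)),
      ∀ l : ℝ, (l - 2) ^ 2 * (1 - l) ^ (k - 1) + 2 * l - 3 = 0 ↔ (l = a ∨ l = b)) ∧
    -- (v) the equation has exactly one root in (0,1)
    (∃ a ∈ Set.Ioo (0 : ℝ) 1, ∀ l ∈ Set.Ioo (0 : ℝ) 1,
      (((l - 2) * (l - 1) ^ (k - 1) + 1) ^ 2 - (1 - l) ^ k = 0 ↔ l = a)) ∧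
    -- 1 is an H-eigenvalue, and there are exactly seven others
    (G.laplacianTensor k).IsHEigenvalue 1 ∧
    {l : ℝ | l ≠ 1 ∧ (G.laplacianTensor k).IsHEigenvalue l}.ncard = 7 ∧
    {l : ℝ | (G.laplacianTensor k).IsHEigenvalue l}.ncard = 8 := by
  obtain ⟨p, rfl⟩ : ∃ p, k = p + 3 := ⟨k - 3, by omega⟩
  have hp : Even p := by
    rcases Nat.even_or_odd p with h | h
    · exact h
    · exact absurd hodd (Nat.not_odd_iff_even.2 (h.add_odd (by decide)))
  have hn : Even (p + 2) := hp.add even_two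
  simp only [show p + 3 - 1 = p + 2 from rfl, show p + 3 - 2 = p + 1 from rfl]
  obtain ⟨x₂, hx₂, h₂⟩ := exists_root_two (n := p + 2) (by omega) hn
  obtain ⟨x₃, hx₃, h₃⟩ := exists_root_three (n := p + 1) hp.add_one
  obtain ⟨x₄, hx₄, r, hr, h₄⟩ := exists_roots_four (n := p + 2) (by omega) hn
  obtain ⟨x₅, hx₅, h₅⟩ := exists_root_five (n := p + 2) (by omega)
  have e₂ := (h₂ x₂).2 rfl
  have e₃ := (h₃ x₃).2 rfl
  have e₄ := (h₄ x₄).2 (Or.inl rfl)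
  have e₅ := (h₅ x₅ hx₅).2 rfl
  -- With P = (1 + x)² x^(p+2), the three equations (ii), (iii), (iv) say P = 1 + x, P = x, P = 1 +
  -- 2x, and (v) gives (P - (1 + x))² = x P. No two are compatible on (0,1).
  have n₂₃ : x₂ ≠ x₃ := by
    rintro rfl
    have : x₂ = 1 + x₂ := by linear_combination (1 + x₂) * e₂ - x₂ * e₃
    linarith
  have n₂₄ : x₂ ≠ x₄ := by
    rintro rfl
    have : 1 + 2 * x₂ = 1 + x₂ := by linear_combination (1 + x₂) * e₂ - e₄
    linarith [hx₂.1]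
  have n₂₅ : x₂ ≠ x₅ := by
    rintro rfl
    rw [e₂] at e₅
    have := pow_pos hx₂.1 (p + 2 + 1)
    linarith
  have n₃₄ : x₃ ≠ x₄ := by
    rintro rfl
    have : 1 + 2 * x₃ = x₃ := by linear_combination x₃ * e₃ - e₄
    linarith [hx₃.1]
  have n₃₅ : x₃ ≠ x₅ := by
    rintro rfl
    have h1 : (1 + x₃) ^ 2 * x₃ ^ (p + 2) = x₃ := by
      linear_combination x₃ * e₃
    have h2 : x₃ ^ 2 = 1 := by
      have h3 : ((1 + x₃) ^ 2 * x₃ ^ (p + 2) - (1 + x₃)) ^ 2 =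
          x₃ * ((1 + x₃) ^ 2 * x₃ ^ (p + 2)) := by
        linear_combination (1 + x₃) ^ 2 * e₅
      rw [h1] at h3
      linear_combination -h3
    nlinarith [hx₃.1, hx₃.2]
  have n₄₅ : x₄ ≠ x₅ := by
    rintro rfl
    have h3 : ((1 + x₄) ^ 2 * x₄ ^ (p + 2) - (1 + x₄)) ^ 2 =
        x₄ * ((1 + x₄) ^ 2 * x₄ ^ (p + 2)) := by
      linear_combination (1 + x₄) ^ 2 * e₅
    rw [e₄] at h3
    nlinarith [hx₄.1, hx₄.2]
  have q₂ : ∀ l : ℝ, (l - 2) * (1 - l) ^ (p + 2) + 1 = 0 ↔ l = 1 - x₂ := by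
    intro l
    rw [show l = 1 - x₂ ↔ 1 - l = x₂ by constructor <;> intro h <;> linarith, ← h₂]
    constructor <;> intro h <;> linear_combination -h
  have q₃ : ∀ l : ℝ, (l - 2) ^ 2 * (1 - l) ^ (p + 1) - 1 = 0 ↔ l = 1 - x₃ := by
    intro l
    rw [show l = 1 - x₃ ↔ 1 - l = x₃ by constructor <;> intro h <;> linarith, ← h₃]
    constructor <;> intro h <;> linear_combination h
  have q₄ : ∀ l : ℝ, (l - 2) ^ 2 * (1 - l) ^ (p + 2) + 2 * l - 3 = 0 ↔
      (l = 1 - x₄ ∨ l = 1 + r) := by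
    intro l
    rw [show l = 1 - x₄ ↔ 1 - l = x₄ by constructor <;> intro h <;> linarith,
      show l = 1 + r ↔ 1 - l = -r by constructor <;> intro h <;> linarith, ← h₄]
    constructor <;> intro h <;> linear_combination h
  have p₅ : ∀ l : ℝ, ((l - 2) * (l - 1) ^ (p + 2) + 1) ^ 2 - (1 - l) ^ (p + 3) = 0 ↔
      ((1 + (1 - l)) * (1 - l) ^ (p + 2) - 1) ^ 2 = (1 - l) ^ (p + 3) := by
    intro l
    rw [← sub_eq_zero (a := (_ - 1) ^ 2), ← neg_sub 1 l, hn.neg_pow]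
    constructor <;> intro h <;> linear_combination h
  have q₅ : ∀ l ∈ Set.Ioo (0 : ℝ) 1,
      (((l - 2) * (l - 1) ^ (p + 2) + 1) ^ 2 - (1 - l) ^ (p + 3) = 0 ↔ l = 1 - x₅) := by
    intro l hl
    rw [p₅, show l = 1 - x₅ ↔ 1 - l = x₅ by constructor <;> intro h <;> linarith,
      ← h₅ (1 - l) ⟨by linarith [hl.2], by linarith [hl.1]⟩]
  have mem : ∀ {x : ℝ}, x ∈ Set.Ioo (0 : ℝ) 1 → 1 - x ∈ Set.Ioo (0 : ℝ) 1 :=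
    fun hx => ⟨by linarith [hx.2], by linarith [hx.1]⟩
  have hchar : ∀ l : ℝ, (l ≠ 1 ∧ (G.laplacianTensor (p + 3)).IsHEigenvalue l) ↔
      l ∈ ({0, 2, 1 + r, 1 - x₂, 1 - x₃, 1 - x₄, 1 - x₅} : Set ℝ) := by
    intro l
    have hE : l ≠ 1 → ((G.laplacianTensor (p + 3)).IsHEigenvalue l ↔
        1 + (1 - l) = 0 ∨ (1 + (1 - l)) * (1 - l) ^ (p + 2) = 1 ∨
        (1 + (1 - l)) ^ 2 * (1 - l) ^ (p + 1) = 1 ∨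
        (1 + (1 - l)) ^ 2 * (1 - l) ^ (p + 2) = 1 + 2 * (1 - l) ∨
        ((1 + (1 - l)) * (1 - l) ^ (p + 2) - 1) ^ 2 = (1 - l) ^ (p + 3)) := fun hl => by
      have := hG.isHEigenvalue_laplacianTensor_iff_of_ne_zero hp (sub_ne_zero.2 hl.symm)
      rwa [sub_sub_cancel] at this
    simp only [Set.mem_insert_iff, Set.mem_singleton_iff]
    constructor
    · rintro ⟨hl, h⟩
      rcases (hE hl).1 h with h | h | h | h | h
      · exact Or.inr (Or.inl (by linarith))
      · have := (h₂ _).1 h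
        exact Or.inr (Or.inr (Or.inr (Or.inl (by linarith))))
      · have := (h₃ _).1 h
        exact Or.inr (Or.inr (Or.inr (Or.inr (Or.inl (by linarith)))))
      · rcases (h₄ _).1 h with h | h
        · exact Or.inr (Or.inr (Or.inr (Or.inr (Or.inr (Or.inl (by linarith))))))
        · exact Or.inr (Or.inr (Or.inl (by linarith)))
      · obtain ⟨hl0, hl1⟩ := mem_Ioc_of_root_five hn (sub_ne_zero.2 hl.symm) h
        -- The endpoint 1 - l = 1 is the eigenvalue 0; interior roots belong to case (v).
        rcases hl1.eq_or_lt with h1 | h1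
        · exact Or.inl (by linarith)
        · have := (h₅ _ ⟨hl0, h1⟩).1 h
          exact Or.inr (Or.inr (Or.inr (Or.inr (Or.inr (Or.inr (by linarith))))))
    · rintro (rfl | rfl | rfl | rfl | rfl | rfl | rfl)
      · refine ⟨by norm_num, (hE (by norm_num)).2 ?_⟩
        norm_num
      · refine ⟨by norm_num, (hE (by norm_num)).2 (Or.inl (by norm_num))⟩
      · have hl : 1 + r ≠ 1 := by simpa using hr.1.ne'
        refine ⟨hl, (hE hl).2 (Or.inr (Or.inr (Or.inr (Or.inl ((h₄ _).2 (Or.inr ?_))))))⟩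
        ring
      · have hl := (mem hx₂).2.ne
        refine ⟨hl, (hE hl).2 (Or.inr (Or.inl ((h₂ _).2 ?_)))⟩
        ring
      · have hl := (mem hx₃).2.ne
        refine ⟨hl, (hE hl).2 (Or.inr (Or.inr (Or.inl ((h₃ _).2 ?_))))⟩
        ring
      · have hl := (mem hx₄).2.ne
        refine ⟨hl, (hE hl).2 (Or.inr (Or.inr (Or.inr (Or.inl ((h₄ _).2 (Or.inl ?_))))))⟩
        ring
      · have hl := (mem hx₅).2.ne
        refine ⟨hl, (hE hl).2 (Or.inr (Or.inr (Or.inr (Or.inr ?_))))⟩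
        rw [sub_sub_cancel]
        exact e₅
  have hset : {l : ℝ | l ≠ 1 ∧ (G.laplacianTensor (p + 3)).IsHEigenvalue l} =
      {0, 2, 1 + r, 1 - x₂, 1 - x₃, 1 - x₄, 1 - x₅} := Set.ext hchar
  have inj : ∀ {x y : ℝ}, x ≠ y → 1 - x ≠ 1 - y := fun h h' => h (by linarith)
  have hseven : {l : ℝ | l ≠ 1 ∧ (G.laplacianTensor (p + 3)).IsHEigenvalue l}.ncard = 7 := by
    rw [hset]
    exact ncard_insert_zero_insert_two (mem hx₂) (mem hx₃) (mem hx₄) (mem hx₅)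
      ⟨by linarith [hr.1], by linarith [hr.2]⟩ (inj n₂₃) (inj n₂₄) (inj n₂₅) (inj n₃₄) (inj n₃₅)
      (inj n₄₅)
  have hone := hG.isHEigenvalue_laplacianTensor_one
  refine ⟨fun l => ?_, ⟨_, mem hx₂, q₂⟩, ⟨_, mem hx₃, q₃⟩,
    ⟨_, mem hx₄, 1 + r, ⟨by linarith [hr.1], ?_⟩, q₄⟩, ⟨_, mem hx₅, q₅⟩, hone, hseven, ?_⟩
  · rw [hchar l, q₂, q₃, q₄]
    simp only [Set.mem_insert_iff, Set.mem_singleton_iff]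
    constructor
    · rintro (h | h | h | h | h | h | h)
      · exact Or.inl (Or.inl h)
      · exact Or.inl (Or.inr h)
      · exact Or.inr (Or.inr (Or.inr (Or.inl (Or.inr h))))
      · exact Or.inr (Or.inl ⟨h ▸ mem hx₂, h⟩)
      · exact Or.inr (Or.inr (Or.inl ⟨h ▸ mem hx₃, h⟩))
      · exact Or.inr (Or.inr (Or.inr (Or.inl (Or.inl h))))
      · have hl : l ∈ Set.Ioo (0 : ℝ) 1 := h ▸ mem hx₅
        exact Or.inr (Or.inr (Or.inr (Or.inr ⟨hl, (q₅ l hl).2 h⟩)))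
    · rintro ((h | h) | ⟨-, h⟩ | ⟨-, h⟩ | (h | h) | ⟨hl, h⟩)
      · simp [h]
      · simp [h]
      · simp [h]
      · simp [h]
      · simp [h]
      · simp [h]
      · simp [(q₅ l hl).1 h]
  · have : 1 + r < 3 / 2 := by linarith [hr.2]
    refine this.trans_le ?_
    rw [div_le_div_iff₀ (by norm_num) (by positivity)]
    push_cast
    linarith [(Nat.cast_nonneg p : (0 : ℝ) ≤ p)]
  · have h : {l : ℝ | (G.laplacianTensor (p + 3)).IsHEigenvalue l} =
        insert 1 {l : ℝ | l ≠ 1 ∧ (G.laplacianTensor (p + 3)).IsHEigenvalue l} := by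
      ext l
      by_cases hl : l = 1
      · simp [hl, hone]
      · simp [hl]
    -- `ncard` is 0 on infinite sets, so the value 7 already gives finiteness.
    rw [h, Set.ncard_insert_of_notMem (by simp) (Set.finite_of_ncard_ne_zero (by omega)), hseven]
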